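/- Let $\mathcal{L}=\{0,1,+,-,\cdot,\le\}$ be the first-order language of arithmetic (with equality, and with the standard model $\mathbb{Z}$), and let $V$ be a set of program variables. Programs are given by $$p ::= \mathbf{skip} \mid x := t \mid p_0;p_1 \mid \mathbf{if}\ B\ \mathbf{then}\ p_0\ \mathbf{else}\ p_1 \mid \mathbf{while}\ B\ \mathbf{do}\ p_0,$$ where $x\in V$, $t$ is an $\mathcal{L}$-term and $B$ a quantifier-free $\mathcal{L}$-formula with variables in $V$. A state is a function $\sigma:V\to\mathbb{Z}$, and $C(p)$ denotes the usual denotational semantics of $p$, a partial function from states to states. A Hoare triple $\{\varphi\}\,p\,\{\psi\}$ consists of a program $p$ and first-order $\mathcal{L}$-formulas $\varphi,\psi$ whose free variables are in $V$. Write $\vdash\{\varphi\}\,p\,\{\psi\}$ if the triple is derivable in the Hoare calculus, whose rules are $$\{\varphi\}\,\mathbf{skip}\,\{\varphi\},\qquad \{\varphi[x\backslash t]\}\,x:=t\,\{\varphi\},\qquad \frac{\{\varphi\}\,p_0\,\{\chi\}\quad\{\chi\}\,p_1\,\{\psi\}}{\{\varphi\}\,p_0;p_1\,\{\psi\}},$$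 $$\frac{\{\varphi\land B\}\,p_0\,\{\psi\}\quad\{\varphi\land\neg B\}\,p_1\,\{\psi\}}{\{\varphi\}\,\mathbf{if}\ B\ \mathbf{then}\ p_0\ \mathbf{else}\ p_1\,\{\psi\}},\qquad \frac{\{\varphi\land B\}\,p_0\,\{\varphi\}}{\{\varphi\}\,\mathbf{while}\ B\ \mathbf{do}\ p_0\,\{\varphi\land\neg B\}},$$ $$\frac{\mathbb{Z}\models\varphi\to\varphi'\quad\{\varphi'\}\,p\,\{\psi'\}\quad\mathbb{Z}\models\psi'\to\psi}{\{\varphi\}\,p\,\{\psi\}},$$ where all assertions are first-order $\mathcal{L}$-formulas and $\mathbb{Z}\models\theta$ for an open formula $\theta$ means truth in $\mathbb{Z}$ under all states. Write $\mathbb{Z}\models\{\varphi\}\,p\,\{\psi\}$ if for every state $\sigma$ with $\mathbb{Z},\sigma\models\varphi$ such that $C(p)(\sigma)$ is defined, $\mathbb{Z},C(p)(\sigma)\models\psi$. The verification condition $\mathrm{vc}(\{\varphi\}\,p\,\{\psi\})$ is the second-order sentence $\exists\bar I\,\forall^*\,\tilde{\mathrm{vc}}(\{\varphi\}\,p\,\{\psi\})$,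 where $\forall^*$ is the universal closure with respect to individual variables, $\exists\bar I$ binds all predicate variables (which range over all relations on $\mathbb{Z}$ of the given arity), and \begin{align*} \tilde{\mathrm{vc}}(\{\varphi\}\,\mathbf{skip}\,\{\psi\}) &= \varphi\to\psi,\\ \tilde{\mathrm{vc}}(\{\varphi\}\,x:=t\,\{\psi\}) &= \varphi\to\psi[x\backslash t],\\ \tilde{\mathrm{vc}}(\{\varphi\}\,p_0;p_1\,\{\psi\}) &= \tilde{\mathrm{vc}}(\{\varphi\}\,p_0\,\{I(\bar x)\})\land\tilde{\mathrm{vc}}(\{I(\bar x)\}\,p_1\,\{\psi\}),\\ \tilde{\mathrm{vc}}(\{\varphi\}\,\mathbf{if}\ B\ \mathbf{then}\ p_0\ \mathbf{else}\ p_1\,\{\psi\}) &= \tilde{\mathrm{vc}}(\{\varphi\land B\}\,p_0\,\{\psi\})\land\tilde{\mathrm{vc}}(\{\varphi\land\neg B\}\,p_1\,\{\psi\}),\\ \tilde{\mathrm{vc}}(\{\varphi\}\,\mathbf{while}\ B\ \mathbf{do}\ p_0\,\{\psi\}) &= \tilde{\mathrm{vc}}(\{I(\bar x)\land B\}\,p_0\,\{I(\bar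 x)\})\land(\varphi\to I(\bar x))\land(I(\bar x)\land\neg B\to\psi). \end{align*} Here $I$ is in each case a fresh predicate variable, and $\bar x$ is a list, without repetition, of the variables that occur free in $\varphi$ or $\psi$, or occur in $p$, for the triple $\{\varphi\}\,p\,\{\psi\}$ whose verification condition is formed. **Theorem.** For every Hoare triple $\{\varphi\}\,p\,\{\psi\}$, $$\vdash\{\varphi\}\,p\,\{\psi\}\quad\Longleftrightarrow\quad\mathbb{Z}\models\{\varphi\}\,p\,\{\psi\}\quad\Longleftrightarrow\quad\mathbb{Z}\models\mathrm{vc}(\{\varphi\}\,p\,\{\psi\}).$$ -/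

import Mathlib

namespace HoareVC

open FirstOrder FirstOrder.Language

universe u

/-! ### The language of arithmetic and its standard model -/

/-- Function symbols `0, 1, +, -, ·` (with `-` binary). -/
inductive ArithFunc : ℕ → Type
  | zero : ArithFunc 0
  | one : ArithFunc 0
  | add : ArithFunc 2
  | sub : ArithFunc 2
  | mul : ArithFunc 2

/-- The relation symbol `≤` (equality is a logical symbol). -/
inductive ArithRel : ℕ → Type
  | le : ArithRel 2

/-- The first-order language of arithmetic `{0, 1, +, -, ·, ≤}`. -/
def arith : FirstOrder.Language.{0, 0} := ⟨ArithFunc, ArithRel⟩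

/-- Interpretation of the function symbols in `ℤ`. -/
def arithFunMap : {n : ℕ} → ArithFunc n → (Fin n → ℤ) → ℤ
  | _, .zero, _ => 0
  | _, .one, _ => 1
  | _, .add, v => v 0 + v 1
  | _, .sub, v => v 0 - v 1
  | _, .mul, v => v 0 * v 1

/-- Interpretation of the relation symbol in `ℤ`. -/
def arithRelMap : {n : ℕ} → ArithRel n → (Fin n → ℤ) → Prop
  | _, .le, v => v 0 ≤ v 1

/-- The standard model `ℤ`. -/
instance arithStructure : arith.Structure ℤ where
  funMap f v := arithFunMap f v
  RelMap r v := arithRelMap r v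

/-! ### Programs and their denotational semantics -/

/-- Programs with program variables in `V`; tests are quantifier-free formulas. -/
inductive Prog (V : Type u) : Type u
  | skip : Prog V
  | assign (x : V) (t : arith.Term V) : Prog V
  | seq (p₀ p₁ : Prog V) : Prog V
  | ite (B : arith.Formula V) (hB : B.IsQF) (p₀ p₁ : Prog V) : Prog V
  | while (B : arith.Formula V) (hB : B.IsQF) (p₀ : Prog V) : Prog V

/-- States assign an integer to every program variable. -/
abbrev State (V : Type u) : Type u := V → ℤ

open Classical in
/-- The denotation of a program, a partial function on states. For a loop it is the iteration of
the body: `PFun.fix` is the least partial function `f` such that `f σ = σ` if `B` is false in `σ`,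
and `f σ = f (C(p₀) σ)` otherwise. -/
noncomputable def den {V : Type u} [DecidableEq V] : Prog V → (State V →. State V)
  | .skip => fun σ => Part.some σ
  | .assign x t => fun σ => Part.some (Function.update σ x (t.realize σ))
  | .seq p₀ p₁ => fun σ => (den p₀ σ).bind (den p₁)
  | .ite B _ p₀ p₁ => fun σ => if B.Realize σ then den p₀ σ else den p₁ σ
  | .while B _ p₀ => PFun.fix fun σ =>
      if B.Realize σ then (den p₀ σ).map Sum.inr else Part.some (Sum.inl σ)

/-- Partial correctness of `{φ} p {ψ}` in `ℤ`: from every state that satisfies `φ`, the program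
either is undefined or ends in a state that satisfies `ψ`. -/
def Valid {V : Type u} [DecidableEq V]
    (φ : arith.Formula V) (p : Prog V) (ψ : arith.Formula V) : Prop :=
  ∀ σ : State V, φ.Realize σ → ∀ σ' ∈ den p σ, ψ.Realize σ'

/-! ### The Hoare calculus -/

/-- The substitution of the term `t` for the variable `x`. -/
def substVar {L : FirstOrder.Language.{0, 0}} {V : Type u} [DecidableEq V] (φ : L.Formula V)
    (x : V) (t : L.Term V) : L.Formula V :=
  BoundedFormula.subst φ (Function.update Term.var x t)

/-- Provability in the Hoare calculus. Assertions are first-order formulas over arithmetic, and the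
side conditions of the rule of consequence refer to truth in `ℤ`. -/
inductive Provable {V : Type u} [DecidableEq V] :
    arith.Formula V → Prog V → arith.Formula V → Prop
  | skip (φ : arith.Formula V) : Provable φ .skip φ
  | assign (φ : arith.Formula V) (x : V) (t : arith.Term V) :
      Provable (substVar φ x t) (.assign x t) φ
  | seq {φ χ ψ : arith.Formula V} {p₀ p₁ : Prog V} :
      Provable φ p₀ χ → Provable χ p₁ ψ → Provable φ (.seq p₀ p₁) ψ
  | ite {φ ψ B : arith.Formula V} {hB : B.IsQF} {p₀ p₁ : Prog V} :
      Provable (φ ⊓ B) p₀ ψ → Provable (φ ⊓ ∼B) p₁ ψ → Provable φ (.ite B hB p₀ p₁) ψ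
  | while {φ B : arith.Formula V} {hB : B.IsQF} {p₀ : Prog V} :
      Provable (φ ⊓ B) p₀ φ → Provable φ (.while B hB p₀) (φ ⊓ ∼B)
  | consequence {φ φ' ψ ψ' : arith.Formula V} {p : Prog V} :
      (∀ σ : State V, φ.Realize σ → φ'.Realize σ) → Provable φ' p ψ' →
      (∀ σ : State V, ψ'.Realize σ → ψ.Realize σ) → Provable φ p ψ

/-! ### Formula equations -/

/-- Predicate variables: for every arity `n`, a sequence `X₀, X₁, …` of `n`-ary ones. -/
def predVar : FirstOrder.Language.{0, 0} := ⟨fun _ => Empty, fun _ => ℕ⟩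

/-- Arithmetic with predicate variables (and only first-order quantifiers). -/
abbrev arithPred : FirstOrder.Language.{0, 0} := arith.sum predVar

/-- The `n`-ary predicate variable of index `i`. -/
def predSym (n i : ℕ) : predVar.Relations n := i

/-- The assignment of relations over `ℤ` to the predicate variables. -/
@[reducible]
def predStructure (R : (n : ℕ) → ℕ → Set (Fin n → ℤ)) : predVar.Structure ℤ where
  funMap f _ := Empty.elim f
  RelMap {n} i v := v ∈ R n i

/-- `∀* φ`, the universal closure of `φ` with respect to individual variables. -/
noncomputable def univClosure {L : FirstOrder.Language.{0, 0}} {V : Type u} [DecidableEq V]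
    (φ : L.Formula V) : L.Sentence :=
  Formula.iAlls φ.freeVarFinset (BoundedFormula.restrictFreeVar φ Sum.inr)

/-- A formula equation `∃ X̄ φ` over arithmetic. It is closed: `φ` has no free individual variables
and the prefix `∃ X̄` binds all predicate variables of `φ`. -/
structure FormulaEquation where
  /-- The formula `φ` below the existential second-order quantifiers. -/
  matrix : arithPred.Sentence

/-- Truth of a formula equation in `ℤ`, with predicate variables ranging over all relations. -/
def FormulaEquation.TrueInZ (E : FormulaEquation) : Prop :=
  ∃ R : (n : ℕ) → ℕ → Set (Fin n → ℤ),
    letI := predStructure R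
    ℤ ⊨ E.matrix

/-! ### The verification condition -/

/-- The variables that occur in a program. -/
def Prog.vars {V : Type u} [DecidableEq V] : Prog V → Finset V
  | .skip => ∅
  | .assign x t => insert x t.varFinset
  | .seq p₀ p₁ => p₀.vars ∪ p₁.vars
  | .ite B _ p₀ p₁ => B.freeVarFinset ∪ p₀.vars ∪ p₁.vars
  | .while B _ p₀ => B.freeVarFinset ∪ p₀.vars

/-- The number of predicate variables in the verification condition of a program. -/
def Prog.numPred {V : Type u} : Prog V → ℕ
  | .skip => 0
  | .assign _ _ => 0
  | .seq p₀ p₁ => 1 + p₀.numPred + p₁.numPred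
  | .ite _ _ p₀ p₁ => p₀.numPred + p₁.numPred
  | .while _ _ p₀ => 1 + p₀.numPred

/-- A formula without predicate variables as a formula with predicate variables. -/
def liftFormula {V : Type u} (φ : arith.Formula V) : arithPred.Formula V :=
  LHom.sumInl.onFormula φ

/-- A term of arithmetic as a term of the language with predicate variables. -/
def liftTerm {V : Type u} (t : arith.Term V) : arithPred.Term V :=
  LHom.sumInl.onTerm t

/-- The atom `I(x̄)` where `I` is the `m`-ary predicate variable of index `i`. -/
def predAtom {V : Type u} {m : ℕ} (x : Fin m → V) (i : ℕ) : arithPred.Formula V :=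
  Relations.formula (Sum.inr (predSym m i) : arithPred.Relations m) fun j => Term.var (x j)

/-- The matrix of the verification condition of `{φ} p {ψ}`. All predicate variables
are applied to the tuple `x̄`. Those introduced are the ones with indices `k, …, k + numPred p - 1`,
each of them once; they are fresh if they do not occur in `φ` and `ψ`. -/
def vcTilde {V : Type u} [DecidableEq V] {m : ℕ} (x : Fin m → V) :
    ℕ → arithPred.Formula V → Prog V → arithPred.Formula V → arithPred.Formula V
  | _, φ, .skip, ψ => φ.imp ψ
  | _, φ, .assign y t, ψ => φ.imp (substVar ψ y (liftTerm t))
  | k, φ, .seq p₀ p₁, ψ =>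
      vcTilde x (k + 1) φ p₀ (predAtom x k) ⊓
        vcTilde x (k + 1 + p₀.numPred) (predAtom x k) p₁ ψ
  | k, φ, .ite B _ p₀ p₁, ψ =>
      vcTilde x k (φ ⊓ liftFormula B) p₀ ψ ⊓
        vcTilde x (k + p₀.numPred) (φ ⊓ ∼(liftFormula B)) p₁ ψ
  | k, φ, .while B _ p₀, ψ =>
      vcTilde x (k + 1) (predAtom x k ⊓ liftFormula B) p₀ (predAtom x k) ⊓
        (φ.imp (predAtom x k) ⊓ (predAtom x k ⊓ ∼(liftFormula B)).imp ψ)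

/-- The (individual) variables of the Hoare triple `{φ} p {ψ}`. -/
def tripleVars {V : Type u} [DecidableEq V]
    (φ : arith.Formula V) (p : Prog V) (ψ : arith.Formula V) : Finset V :=
  φ.freeVarFinset ∪ p.vars ∪ ψ.freeVarFinset

/-- The verification condition `∃ Ī ∀* ṽc({φ} p {ψ})`; the predicate variables take as arguments
the variables of the triple, each listed once. -/
noncomputable def vc {V : Type u} [DecidableEq V]
    (φ : arith.Formula V) (p : Prog V) (ψ : arith.Formula V) : FormulaEquation where
  matrix := univClosure <|
    vcTilde (fun i => ((tripleVars φ p ψ).equivFin.symm i : V)) 0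
      (liftFormula φ) p (liftFormula ψ)

end HoareVC

namespace HoareVC

open FirstOrder FirstOrder.Language

universe u v w

/-! ### Semantics of programs -/

section Semantics

variable {V : Type u} [DecidableEq V]

/-! Everything passes through the weakest liberal precondition `wlp`. As intermediate assertion of a
composition take the `wlp` of its second part; as loop invariant take the `wlp` of the whole loop. A
correct triple admits these choices at every node of the program, both in a Hoare derivation and in
the verification condition.

For the verification condition the predicates range over all relations, so the only point to check
is that `wlp` depends on the variables of the triple alone (`wlp_congr`, `exists_semVC`).
Conversely, any relations that satisfy the condition are intermediate assertions and invariants,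
which gives correctness by induction on the program (`SemVC.wlp`).

In the calculus the assertions must be formulas, so `wlp` has to be arithmetically definable
(`exists_formula_wlp`). The hard case is the loop: its graph is the reflexive transitive closure of
the body's graph, and a finite run is coded by integers with Gödel's β-function
(`reflTransGen_iff_coded`). Soundness of the calculus is a direct induction on derivations. -/

/-- The weakest liberal precondition of a program for a set of final states. -/
def wlp (p : Prog V) (Q : State V → Prop) (σ : State V) : Prop :=
  ∀ τ ∈ den p σ, Q τ

/-- One iteration of a loop. -/
def LoopStep (B : arith.Formula V) (p : Prog V) (σ τ : State V) : Prop :=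
  B.Realize σ ∧ τ ∈ den p σ

theorem mem_den_seq {p₀ p₁ : Prog V} {σ τ : State V} :
    τ ∈ den (.seq p₀ p₁) σ ↔ ∃ ρ ∈ den p₀ σ, τ ∈ den p₁ ρ :=
  Part.mem_bind_iff

theorem mem_den_ite {B : arith.Formula V} {hB : B.IsQF} {p₀ p₁ : Prog V} {σ τ : State V} :
    τ ∈ den (.ite B hB p₀ p₁) σ ↔
      (B.Realize σ ∧ τ ∈ den p₀ σ) ∨ (¬ B.Realize σ ∧ τ ∈ den p₁ σ) := by
  by_cases h : B.Realize σ <;> simp [den, h]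

theorem mem_den_while_iff {B : arith.Formula V} {hB : B.IsQF} {p : Prog V} {σ τ : State V} :
    τ ∈ den (.while B hB p) σ ↔
      (¬ B.Realize σ ∧ τ = σ) ∨ ∃ ρ, LoopStep B p σ ρ ∧ τ ∈ den (.while B hB p) ρ := by
  refine PFun.mem_fix_iff.trans ?_
  change _ ↔ _ ∨ ∃ ρ, LoopStep B p σ ρ ∧ τ ∈ PFun.fix _ ρ
  by_cases h : B.Realize σ <;> simp [h, LoopStep]

/-- Trades the fixed point for finite runs of the body. Runs support induction from their last step,
as needed for invariants, and they can be coded in arithmetic. -/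
theorem mem_den_while {B : arith.Formula V} {hB : B.IsQF} {p : Prog V} {σ τ : State V} :
    τ ∈ den (.while B hB p) σ ↔
      Relation.ReflTransGen (LoopStep B p) σ τ ∧ ¬ B.Realize τ := by
  constructor
  · intro h
    have h' := h
    rw [den] at h'
    refine PFun.fixInduction (C := fun σ => τ ∈ den (.while B hB p) σ →
      Relation.ReflTransGen (LoopStep B p) σ τ ∧ ¬ B.Realize τ) h' ?_ h
    intro σ _ ih hσ
    rcases mem_den_while_iff.1 hσ with ⟨hB', rfl⟩ | ⟨ρ, hρ, hτ⟩
    · exact ⟨.refl, hB'⟩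
    · obtain ⟨h₁, h₂⟩ := ih ρ (by simp [hρ.1, hρ.2]) hτ
      exact ⟨h₁.head hρ, h₂⟩
  · rintro ⟨h, hτ⟩
    induction h using Relation.ReflTransGen.head_induction_on with
    | refl => exact mem_den_while_iff.2 (.inl ⟨hτ, rfl⟩)
    | head h _ ih => exact mem_den_while_iff.2 (.inr ⟨_, h, ih⟩)

/-! ### Locality, substitution and universal closure -/

theorem realize_term_congr {L : FirstOrder.Language.{0, 0}} [L.Structure ℤ] {t : L.Term V}
    {σ σ' : State V} (h : Set.EqOn σ σ' t.varFinset) : t.realize σ = t.realize σ' := by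
  induction t with
  | var x => exact h (by simp)
  | func f ts ih =>
    simp only [Term.realize_func]
    congr 1
    funext i
    exact ih i fun x hx => h (by simpa using ⟨i, hx⟩)

theorem realize_formula_congr {L : FirstOrder.Language.{0, 0}} [L.Structure ℤ] {φ : L.Formula V}
    {σ σ' : State V} (h : Set.EqOn σ σ' φ.freeVarFinset) : φ.Realize σ ↔ φ.Realize σ' := by
  have e : ∀ ρ : State V, Formula.Realize
      (BoundedFormula.restrictFreeVar φ id : L.Formula φ.freeVarFinset) (fun a => ρ a) ↔ φ.Realize ρ :=
    fun ρ => BoundedFormula.realize_restrictFreeVar (f := id)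
      (v := fun a : φ.freeVarFinset => ρ a) ρ fun _ => rfl
  have : (fun a : φ.freeVarFinset => σ a) = fun a : φ.freeVarFinset => σ' a :=
    funext fun a => h a.2
  rw [← e, ← e, this]

theorem realize_substVar {L : FirstOrder.Language.{0, 0}} [L.Structure ℤ] {φ : L.Formula V}
    {x : V} {t : L.Term V} {σ : State V} :
    (substVar φ x t).Realize σ ↔ φ.Realize (Function.update σ x (t.realize σ)) := by
  rw [substVar, Formula.Realize, BoundedFormula.realize_subst, Formula.Realize]
  have : (fun a => (Function.update Term.var x t a : L.Term V).realize σ) =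
      Function.update σ x (t.realize σ) := by
    funext a
    by_cases h : a = x
    · subst h; simp
    · simp [h]
  rw [this]

theorem realize_univClosure {L : FirstOrder.Language.{0, 0}} [L.Structure ℤ] {φ : L.Formula V} :
    ℤ ⊨ univClosure φ ↔ ∀ σ : State V, φ.Realize σ := by
  rw [Sentence.Realize, univClosure, Formula.realize_iAlls]
  have e : ∀ (d : Empty → ℤ) (i : φ.freeVarFinset → ℤ) (σ : State V), (∀ a, i a = σ a) →
      (Formula.Realize (BoundedFormula.restrictFreeVar φ Sum.inr : L.Formula (Empty ⊕ _))
        (fun a => Sum.elim d i a) ↔ φ.Realize σ) := fun d i σ h =>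
    BoundedFormula.realize_restrictFreeVar σ h
  constructor
  · intro h σ
    exact (e _ (fun a => σ a) σ fun _ => rfl).1 (h _)
  · intro h i
    -- The closure binds only the free variables of `φ`; the value 0 elsewhere is arbitrary.
    refine (e _ i (fun a => if ha : a ∈ φ.freeVarFinset then i ⟨a, ha⟩ else 0) ?_).2 (h _)
    simp

/-- A program only changes its own variables. -/
theorem den_eq_of_notMem {p : Prog V} {σ τ : State V} (h : τ ∈ den p σ) {y : V}
    (hy : y ∉ p.vars) : τ y = σ y := by
  induction p generalizing σ τ with
  | skip => simp [den] at h; rw [h]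
  | assign x t =>
    simp only [den, Part.mem_some_iff] at h
    simp only [Prog.vars, Finset.mem_insert, not_or] at hy
    rw [h, Function.update_of_ne hy.1]
  | seq p₀ p₁ ih₀ ih₁ =>
    simp only [Prog.vars, Finset.mem_union, not_or] at hy
    obtain ⟨ρ, h₀, h₁⟩ := mem_den_seq.1 h
    rw [ih₁ h₁ hy.2, ih₀ h₀ hy.1]
  | ite B hB p₀ p₁ ih₀ ih₁ =>
    simp only [Prog.vars, Finset.mem_union, not_or] at hy
    rcases mem_den_ite.1 h with h | h
    exacts [ih₀ h.2 hy.1.2, ih₁ h.2 hy.2]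
  | _ B hB p ih =>
    simp only [Prog.vars, Finset.mem_union, not_or] at hy
    have h' := (mem_den_while.1 h).1
    clear h
    induction h' with
    | refl => rfl
    | tail _ h ih' => rw [ih h.2 hy.2, ih']

/-- The behaviour of a program only depends on its own variables. -/
theorem exists_den_of_eqOn {X : Set V} {p : Prog V} (hp : (p.vars : Set V) ⊆ X)
    {σ σ' τ : State V} (hσ : Set.EqOn σ σ' X) (h : τ ∈ den p σ) :
    ∃ τ' ∈ den p σ', Set.EqOn τ τ' X := by
  induction p generalizing σ σ' τ with
  | skip => exact ⟨σ', by simp [den], by simp [den] at h; rwa [h]⟩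
  | assign x t =>
    simp only [Prog.vars, Finset.coe_insert, Set.insert_subset_iff] at hp
    simp only [den, Part.mem_some_iff] at h
    refine ⟨Function.update σ' x (t.realize σ'), by simp [den], ?_⟩
    intro y hy
    rw [h, realize_term_congr (hσ.mono hp.2)]
    by_cases e : y = x
    · subst e; simp
    · simp [e, hσ hy]
  | seq p₀ p₁ ih₀ ih₁ =>
    simp only [Prog.vars, Finset.coe_union, Set.union_subset_iff] at hp
    obtain ⟨ρ, h₀, h₁⟩ := mem_den_seq.1 h
    obtain ⟨ρ', h₀', e⟩ := ih₀ hp.1 hσ h₀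
    obtain ⟨τ', h₁', e'⟩ := ih₁ hp.2 e h₁
    exact ⟨τ', mem_den_seq.2 ⟨ρ', h₀', h₁'⟩, e'⟩
  | ite B hB p₀ p₁ ih₀ ih₁ =>
    simp only [Prog.vars, Finset.coe_union, Set.union_subset_iff] at hp
    have hB' := realize_formula_congr (hσ.mono hp.1.1)
    rcases mem_den_ite.1 h with ⟨hb, h⟩ | ⟨hb, h⟩
    · obtain ⟨τ', h', e⟩ := ih₀ hp.1.2 hσ h
      exact ⟨τ', mem_den_ite.2 (.inl ⟨hB'.1 hb, h'⟩), e⟩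
    · obtain ⟨τ', h', e⟩ := ih₁ hp.2 hσ h
      exact ⟨τ', mem_den_ite.2 (.inr ⟨mt hB'.2 hb, h'⟩), e⟩
  | _ B hB p ih =>
    simp only [Prog.vars, Finset.coe_union, Set.union_subset_iff] at hp
    obtain ⟨h', hb⟩ := mem_den_while.1 h
    suffices H : ∃ τ', Relation.ReflTransGen (LoopStep B p) σ' τ' ∧ Set.EqOn τ τ' X by
      obtain ⟨τ', h', e⟩ := H
      exact ⟨τ', mem_den_while.2 ⟨h', mt (realize_formula_congr (e.mono hp.1)).2 hb⟩, e⟩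
    clear hb h
    induction h' with
    | refl => exact ⟨σ', .refl, hσ⟩
    | tail _ h ih' =>
      obtain ⟨ρ', h₁, e⟩ := ih'
      obtain ⟨τ', h₂, e'⟩ := ih hp.2 e h.2
      exact ⟨τ', h₁.tail ⟨(realize_formula_congr (e.mono hp.1)).1 h.1, h₂⟩, e'⟩

theorem wlp_congr {X : Set V} {p : Prog V} (hp : (p.vars : Set V) ⊆ X) {Q : State V → Prop}
    (hQ : ∀ σ σ', Set.EqOn σ σ' X → Q σ → Q σ') {σ σ' : State V} (hσ : Set.EqOn σ σ' X)
    (h : wlp p Q σ) : wlp p Q σ' := fun _ hτ =>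
  let ⟨τ', hτ', e⟩ := exists_den_of_eqOn hp hσ.symm hτ
  hQ τ' _ e.symm (h τ' hτ')

/-- With `wlp_while_exit`, this makes the `wlp` of a loop an invariant strong enough for the
postcondition. -/
theorem wlp_while_step {B : arith.Formula V} {hB : B.IsQF} {p : Prog V} {Q : State V → Prop}
    {σ : State V} (h : wlp (.while B hB p) Q σ) (hb : B.Realize σ) :
    wlp p (wlp (.while B hB p) Q) σ := fun _ hτ τ' hτ' =>
  h τ' (mem_den_while_iff.2 (.inr ⟨_, ⟨hb, hτ⟩, hτ'⟩))

theorem wlp_while_exit {B : arith.Formula V} {hB : B.IsQF} {p : Prog V} {Q : State V → Prop}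
    {σ : State V} (h : wlp (.while B hB p) Q σ) (hb : ¬ B.Realize σ) : Q σ :=
  h σ (mem_den_while_iff.2 (.inl ⟨hb, rfl⟩))

/-- A loop preserves every invariant of its body. -/
theorem wlp_while_of_invariant {B : arith.Formula V} {hB : B.IsQF} {p : Prog V}
    {I : State V → Prop} (hI : ∀ σ, I σ → B.Realize σ → wlp p I σ) {σ : State V} (hσ : I σ) :
    wlp (.while B hB p) (fun τ => I τ ∧ ¬ B.Realize τ) σ := by
  intro τ hτ
  obtain ⟨h, hb⟩ := mem_den_while.1 hτ
  refine ⟨?_, hb⟩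
  clear hτ hb
  induction h with
  | refl => exact hσ
  | tail _ h ih => exact hI _ ih h.1 _ h.2

/-- Soundness of the Hoare calculus. -/
theorem Provable.valid {φ ψ : arith.Formula V} {p : Prog V} (h : Provable φ p ψ) :
    Valid φ p ψ := by
  induction h with
  | skip φ => intro σ hσ τ hτ; simp [den] at hτ; rwa [hτ]
  | assign φ x t =>
    intro σ hσ τ hτ
    simp only [den, Part.mem_some_iff] at hτ
    rw [hτ, ← realize_substVar]
    exact hσ
  | seq _ _ ih₀ ih₁ =>
    intro σ hσ τ hτ
    obtain ⟨ρ, h₀, h₁⟩ := mem_den_seq.1 hτ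
    exact ih₁ ρ (ih₀ σ hσ ρ h₀) τ h₁
  | ite _ _ ih₀ ih₁ =>
    intro σ hσ τ hτ
    rcases mem_den_ite.1 hτ with ⟨hb, h⟩ | ⟨hb, h⟩
    · exact ih₀ σ (Formula.realize_inf.2 ⟨hσ, hb⟩) τ h
    · exact ih₁ σ (Formula.realize_inf.2 ⟨hσ, Formula.realize_not.2 hb⟩) τ h
  | consequence h₁ _ h₂ ih => exact fun σ hσ τ hτ => h₂ τ (ih σ (h₁ σ hσ) τ hτ)
  | _ _ ih =>
    rename_i φ B hB p₀ _
    intro σ hσ τ hτ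
    have := wlp_while_of_invariant (hB := hB) (I := φ.Realize) (p := p₀)
      (fun ρ hρ hb => ih ρ (Formula.realize_inf.2 ⟨hρ, hb⟩)) hσ τ hτ
    exact Formula.realize_inf.2 ⟨this.1, Formula.realize_not.2 this.2⟩

end Semantics

/-! ### The verification condition -/

section VerificationCondition

variable {V : Type u} [DecidableEq V] {m : ℕ}

/-- The truth of the universal closure of `vcTilde`, for pre- and postconditions given as sets of
states, where `S k` interprets the predicate variable of index `k`. -/
def SemVC (x : Fin m → V) (S : ℕ → Set (Fin m → ℤ)) :
    ℕ → (State V → Prop) → Prog V → (State V → Prop) → Prop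
  | _, P, .skip, Q => ∀ σ, P σ → Q σ
  | _, P, .assign y t, Q => ∀ σ, P σ → Q (Function.update σ y (t.realize σ))
  | k, P, .seq p₀ p₁, Q =>
      SemVC x S (k + 1) P p₀ (fun σ => σ ∘ x ∈ S k) ∧
        SemVC x S (k + 1 + p₀.numPred) (fun σ => σ ∘ x ∈ S k) p₁ Q
  | k, P, .ite B _ p₀ p₁, Q =>
      SemVC x S k (fun σ => P σ ∧ B.Realize σ) p₀ Q ∧
        SemVC x S (k + p₀.numPred) (fun σ => P σ ∧ ¬ B.Realize σ) p₁ Q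
  | k, P, .while B _ p₀, Q =>
      SemVC x S (k + 1) (fun σ => σ ∘ x ∈ S k ∧ B.Realize σ) p₀ (fun σ => σ ∘ x ∈ S k) ∧
        (∀ σ, P σ → σ ∘ x ∈ S k) ∧ ∀ σ, σ ∘ x ∈ S k ∧ ¬ B.Realize σ → Q σ

omit [DecidableEq V] in
theorem realize_liftFormula {R : (n : ℕ) → ℕ → Set (Fin n → ℤ)} {φ : arith.Formula V}
    {σ : State V} :
    letI := predStructure R
    (liftFormula φ).Realize σ ↔ φ.Realize σ := by
  let := predStructure R
  exact LHom.realize_onFormula _ _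

omit [DecidableEq V] in
theorem realize_liftTerm {R : (n : ℕ) → ℕ → Set (Fin n → ℤ)} {t : arith.Term V}
    {σ : State V} :
    letI := predStructure R
    (liftTerm t).realize σ = t.realize σ := by
  let := predStructure R
  exact LHom.realize_onTerm _ _ _

omit [DecidableEq V] in
theorem realize_predAtom {R : (n : ℕ) → ℕ → Set (Fin n → ℤ)} {x : Fin m → V} {k : ℕ}
    {σ : State V} :
    letI := predStructure R
    (predAtom x k).Realize σ ↔ σ ∘ x ∈ R m k := by
  let := predStructure R
  exact Formula.realize_rel

/-- The universal closure distributes over the conjunctions of `vcTilde`, so each implication is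
closed separately. `P` and `Q` are arbitrary because the recursion replaces the pre- and
postcondition. -/
theorem forall_realize_vcTilde {R : (n : ℕ) → ℕ → Set (Fin n → ℤ)} {x : Fin m → V} {p : Prog V}
    {k : ℕ} {φ ψ : arithPred.Formula V} {P Q : State V → Prop} :
    letI := predStructure R
    (∀ σ : State V, φ.Realize σ ↔ P σ) → (∀ σ : State V, ψ.Realize σ ↔ Q σ) →
      ((∀ σ : State V, (vcTilde x k φ p ψ).Realize σ) ↔ SemVC x (R m) k P p Q) := by
  let := predStructure R
  intro hφ hψ
  have hI : ∀ k (σ : State V), (predAtom x k : arithPred.Formula V).Realize σ ↔ σ ∘ x ∈ R m k :=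
    fun _ _ => realize_predAtom
  induction p generalizing k φ ψ P Q with
  | skip => simp only [vcTilde, SemVC, Formula.realize_imp, hφ, hψ]
  | assign y t =>
    simp only [vcTilde, SemVC, Formula.realize_imp, realize_substVar, hφ, hψ, realize_liftTerm]
  | seq p₀ p₁ ih₀ ih₁ =>
    simp only [vcTilde, SemVC, Formula.realize_inf, forall_and]
    exact and_congr (ih₀ hφ (hI k)) (ih₁ (hI _) hψ)
  | ite B hB p₀ p₁ ih₀ ih₁ =>
    simp only [vcTilde, SemVC, Formula.realize_inf, forall_and]
    exact and_congr (ih₀ (fun σ => by rw [Formula.realize_inf, hφ, realize_liftFormula]) hψ)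
      (ih₁ (fun σ => by rw [Formula.realize_inf, hφ, Formula.realize_not, realize_liftFormula]) hψ)
  | _ B hB p₀ ih =>
    simp only [vcTilde, SemVC, Formula.realize_inf, forall_and]
    refine and_congr
      (ih (fun σ => by rw [Formula.realize_inf, hI k, realize_liftFormula]) (hI k)) ?_
    simp only [Formula.realize_imp, Formula.realize_inf, Formula.realize_not, hI, hφ, hψ,
      realize_liftFormula]

/-- Any solution supplies intermediate assertions and loop invariants; no definability of the
relations is involved. -/
theorem SemVC.wlp {x : Fin m → V} {S : ℕ → Set (Fin m → ℤ)} {p : Prog V} {k : ℕ}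
    {P Q : State V → Prop} (h : SemVC x S k P p Q) {σ : State V} (hσ : P σ) : wlp p Q σ := by
  induction p generalizing k P Q σ with
  | skip => intro τ hτ; simp [den] at hτ; rw [hτ]; exact h σ hσ
  | assign y t =>
    intro τ hτ
    simp only [den, Part.mem_some_iff] at hτ
    rw [hτ]
    exact h σ hσ
  | seq p₀ p₁ ih₀ ih₁ =>
    intro τ hτ
    obtain ⟨ρ, h₀, h₁⟩ := mem_den_seq.1 hτ
    exact ih₁ h.2 (ih₀ h.1 hσ ρ h₀) τ h₁
  | ite B hB p₀ p₁ ih₀ ih₁ =>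
    intro τ hτ
    rcases mem_den_ite.1 hτ with ⟨hb, h'⟩ | ⟨hb, h'⟩
    exacts [ih₀ h.1 ⟨hσ, hb⟩ τ h', ih₁ h.2 ⟨hσ, hb⟩ τ h']
  | _ B hB p₀ ih =>
    exact fun τ hτ => h.2.2 τ (wlp_while_of_invariant (I := fun σ => σ ∘ x ∈ S k)
      (fun σ hσ hb => ih h.1 ⟨hσ, hb⟩) (h.2.1 σ hσ) τ hτ)

/-- Only the block of indices allotted to `p` is consulted, so solutions for subprograms can be
glued along disjoint blocks. -/
theorem SemVC.congr {x : Fin m → V} {S S' : ℕ → Set (Fin m → ℤ)} {p : Prog V} {k : ℕ}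
    {P Q : State V → Prop} (hS : ∀ i, k ≤ i → i < k + p.numPred → S i = S' i)
    (h : SemVC x S k P p Q) : SemVC x S' k P p Q := by
  induction p generalizing k P Q with
  | skip => exact h
  | assign y t => exact h
  | seq p₀ p₁ ih₀ ih₁ =>
    simp only [Prog.numPred] at hS
    simp only [SemVC, ← hS k le_rfl (by lia)]
    exact ⟨ih₀ (fun i _ _ => hS i (by lia) (by lia)) h.1,
      ih₁ (fun i _ _ => hS i (by lia) (by lia)) h.2⟩
  | ite B hB p₀ p₁ ih₀ ih₁ =>
    simp only [Prog.numPred] at hS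
    exact ⟨ih₀ (fun i _ _ => hS i (by lia) (by lia)) h.1,
      ih₁ (fun i _ _ => hS i (by lia) (by lia)) h.2⟩
  | _ B hB p₀ ih =>
    simp only [Prog.numPred] at hS
    simp only [SemVC, ← hS k le_rfl (by lia)]
    exact ⟨ih (fun i _ _ => hS i (by lia) (by lia)) h.1, h.2⟩

theorem exists_comp_mem_iff_wlp {x : Fin m → V} {p : Prog V}
    (hp : (p.vars : Set V) ⊆ Set.range x) {Q : State V → Prop}
    (hQ : ∀ σ σ', Set.EqOn σ σ' (Set.range x) → Q σ → Q σ') :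
    ∃ A : Set (Fin m → ℤ), ∀ σ : State V, σ ∘ x ∈ A ↔ wlp p Q σ := by
  -- States with the same tuple of values agree on the range of `x`, so by `wlp_congr` one of them
  -- satisfies `wlp` as soon as another does.
  refine ⟨{v | ∀ σ : State V, σ ∘ x = v → wlp p Q σ}, fun σ => ⟨fun h => h σ rfl, ?_⟩⟩
  rintro h σ' e
  refine wlp_congr hp hQ ?_ h
  rintro _ ⟨i, rfl⟩
  exact (congrFun e i).symm

/-- Every correct program has relations that satisfy its verification condition. -/
theorem exists_semVC {x : Fin m → V} {p : Prog V} (hp : (p.vars : Set V) ⊆ Set.range x) {k : ℕ}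
    {P Q : State V → Prop} (hQ : ∀ σ σ', Set.EqOn σ σ' (Set.range x) → Q σ → Q σ')
    (h : ∀ σ, P σ → wlp p Q σ) : ∃ S, SemVC x S k P p Q := by
  have hI : ∀ (A : Set (Fin m → ℤ)) (σ σ' : State V), Set.EqOn σ σ' (Set.range x) →
      σ ∘ x ∈ A → σ' ∘ x ∈ A := by
    intro A σ σ' e hσ
    rwa [show σ' ∘ x = σ ∘ x from funext fun i => (e ⟨i, rfl⟩).symm]
  induction p generalizing k P Q with
  | skip => exact ⟨fun _ => ∅, fun σ hσ => h σ hσ σ (by simp [den])⟩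
  | assign y t => exact ⟨fun _ => ∅, fun σ hσ => h σ hσ _ (by simp [den])⟩
  | seq p₀ p₁ ih₀ ih₁ =>
    simp only [Prog.vars, Finset.coe_union, Set.union_subset_iff] at hp
    obtain ⟨A, hA'⟩ := exists_comp_mem_iff_wlp hp.2 hQ
    have hA₀ : ∀ σ, P σ → wlp p₀ (fun σ : State V => σ ∘ x ∈ A) σ := fun σ hσ ρ hρ =>
      (hA' ρ).2 fun τ hτ => h σ hσ τ (mem_den_seq.2 ⟨ρ, hρ, hτ⟩)
    obtain ⟨S₀, h₀⟩ := ih₀ hp.1 (k := k + 1) (hI A) hA₀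
    obtain ⟨S₁, h₁⟩ := ih₁ hp.2 (k := k + 1 + p₀.numPred) hQ (fun σ => (hA' σ).1)
    -- Index `k` is the new predicate, the next `p₀.numPred` indices belong to `p₀`, the later ones
    -- to `p₁`.
    refine ⟨fun i => if i = k then A else if i < k + 1 + p₀.numPred then S₀ i else S₁ i, ?_, ?_⟩
    · simp only [if_true]
      exact h₀.congr fun i _ _ => by rw [if_neg (by lia), if_pos (by lia)]
    · simp only [if_true]
      exact h₁.congr fun i _ _ => by rw [if_neg (by lia), if_neg (by lia)]
  | ite B hB p₀ p₁ ih₀ ih₁ =>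
    simp only [Prog.vars, Finset.coe_union, Set.union_subset_iff] at hp
    obtain ⟨S₀, h₀⟩ := ih₀ hp.1.2 (k := k) (P := fun σ => P σ ∧ B.Realize σ) hQ
      (fun σ hσ τ hτ => h σ hσ.1 τ (mem_den_ite.2 (.inl ⟨hσ.2, hτ⟩)))
    obtain ⟨S₁, h₁⟩ := ih₁ hp.2 (k := k + p₀.numPred) (P := fun σ => P σ ∧ ¬ B.Realize σ) hQ
      (fun σ hσ τ hτ => h σ hσ.1 τ (mem_den_ite.2 (.inr ⟨hσ.2, hτ⟩)))
    refine ⟨fun i => if i < k + p₀.numPred then S₀ i else S₁ i, ?_, ?_⟩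
    · exact h₀.congr fun i _ _ => by rw [if_pos (by lia)]
    · exact h₁.congr fun i _ _ => by rw [if_neg (by lia)]
  | _ B hB p₀ ih =>
    -- The invariant is the `wlp` of the whole loop.
    obtain ⟨A, hA'⟩ := exists_comp_mem_iff_wlp hp hQ
    simp only [Prog.vars, Finset.coe_union, Set.union_subset_iff] at hp
    have hA₀ : ∀ σ : State V, σ ∘ x ∈ A ∧ B.Realize σ → wlp p₀ (fun σ : State V => σ ∘ x ∈ A) σ :=
      fun σ hσ ρ hρ => (hA' ρ).2 (wlp_while_step ((hA' σ).1 hσ.1) hσ.2 ρ hρ)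
    obtain ⟨S₀, h₀⟩ := ih hp.2 (k := k + 1) (hI A) hA₀
    refine ⟨fun i => if i = k then A else S₀ i, ?_, ?_, ?_⟩
    · simp only [if_true]
      exact h₀.congr fun i _ _ => by rw [if_neg (by lia)]
    · simp only [if_true]
      exact fun σ hσ => (hA' σ).2 (h σ hσ)
    · simp only [if_true]
      exact fun σ hσ => wlp_while_exit ((hA' σ).1 hσ.1) hσ.2

theorem valid_iff_trueInZ_vc (φ : arith.Formula V) (p : Prog V) (ψ : arith.Formula V) :
    Valid φ p ψ ↔ (vc φ p ψ).TrueInZ := by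
  set x : Fin (tripleVars φ p ψ).card → V := fun i => ((tripleVars φ p ψ).equivFin.symm i : V)
    with hx
  have hr : Set.range x = tripleVars φ p ψ := by
    rw [hx, show (fun i => ((tripleVars φ p ψ).equivFin.symm i : V)) =
      Subtype.val ∘ (tripleVars φ p ψ).equivFin.symm from rfl, Set.range_comp]
    simp
  have key : ∀ R, (letI := predStructure R; ℤ ⊨ (vc φ p ψ).matrix) ↔
      SemVC x (R _) 0 φ.Realize p ψ.Realize := fun R => by
    let := predStructure R
    exact realize_univClosure.trans
      (forall_realize_vcTilde (fun _ => realize_liftFormula) fun _ => realize_liftFormula)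
  simp only [FormulaEquation.TrueInZ, key]
  constructor
  · intro h
    obtain ⟨S, hS⟩ := exists_semVC (x := x) (k := 0) (P := φ.Realize) (Q := ψ.Realize)
      (by rw [hr]; intro; simp +contextual [tripleVars]) (fun σ σ' e => (realize_formula_congr (e.mono
        (by rw [hr]; intro; simp +contextual [tripleVars]))).1) h
    -- Only predicates whose arity is the number of variables of the triple occur; the other arities
    -- are filled with `∅`.
    exact ⟨fun n k => if hn : n = _ then hn ▸ S k else ∅, by simpa using hS⟩
  · rintro ⟨R, hR⟩ σ hσ
    exact hR.wlp hσ

end VerificationCondition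

/-! ### Arithmetical definability -/

section Definability

variable {α : Type u} {β : Type v} {γ : Type w}

/-- A set of assignments of integers that is defined by an arithmetical formula. -/
def ArithDef (P : (α → ℤ) → Prop) : Prop :=
  ∃ φ : arith.Formula α, ∀ v, φ.Realize v ↔ P v

/-- A function of assignments of integers that is given by an arithmetical term. -/
def ArithTerm (f : (α → ℤ) → ℤ) : Prop :=
  ∃ t : arith.Term α, ∀ v, t.realize v = f v

theorem ArithTerm.var (a : α) : ArithTerm fun v => v a :=
  ⟨Term.var a, fun _ => rfl⟩

theorem ArithTerm.zero : ArithTerm fun _ : α → ℤ => 0 :=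
  ⟨Term.func (L := arith) ArithFunc.zero Fin.elim0, fun _ => rfl⟩

theorem ArithTerm.one : ArithTerm fun _ : α → ℤ => 1 :=
  ⟨Term.func (L := arith) ArithFunc.one Fin.elim0, fun _ => rfl⟩

theorem ArithTerm.add {f g : (α → ℤ) → ℤ} (hf : ArithTerm f) (hg : ArithTerm g) :
    ArithTerm fun v => f v + g v := by
  obtain ⟨s, hs⟩ := hf
  obtain ⟨t, ht⟩ := hg
  exact ⟨Term.func (L := arith) ArithFunc.add ![s, t], fun v => congrArg₂ (· + ·) (hs v) (ht v)⟩

theorem ArithTerm.mul {f g : (α → ℤ) → ℤ} (hf : ArithTerm f) (hg : ArithTerm g) :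
    ArithTerm fun v => f v * g v := by
  obtain ⟨s, hs⟩ := hf
  obtain ⟨t, ht⟩ := hg
  exact ⟨Term.func (L := arith) ArithFunc.mul ![s, t], fun v => congrArg₂ (· * ·) (hs v) (ht v)⟩

theorem ArithTerm.comp {f : (β → ℤ) → ℤ} (hf : ArithTerm f) {g : (α → ℤ) → β → ℤ}
    (hg : ∀ b, ArithTerm fun v => g v b) : ArithTerm fun v => f (g v) := by
  obtain ⟨t, ht⟩ := hf
  choose s hs using hg
  refine ⟨t.subst s, fun v => ?_⟩
  rw [Term.realize_subst, ht]
  simp only [hs]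

theorem ArithDef.eq {f g : (α → ℤ) → ℤ} (hf : ArithTerm f) (hg : ArithTerm g) :
    ArithDef fun v => f v = g v := by
  obtain ⟨s, hs⟩ := hf
  obtain ⟨t, ht⟩ := hg
  exact ⟨s.equal t, fun v => by rw [Formula.realize_equal, hs, ht]⟩

theorem ArithDef.le {f g : (α → ℤ) → ℤ} (hf : ArithTerm f) (hg : ArithTerm g) :
    ArithDef fun v => f v ≤ g v := by
  obtain ⟨s, hs⟩ := hf
  obtain ⟨t, ht⟩ := hg
  refine ⟨Relations.formula (L := arith) ArithRel.le ![s, t], fun v => ?_⟩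
  refine Formula.realize_rel.trans ?_
  change s.realize v ≤ t.realize v ↔ f v ≤ g v
  rw [hs, ht]

theorem ArithDef.not {P : (α → ℤ) → Prop} (hP : ArithDef P) : ArithDef fun v => ¬ P v := by
  obtain ⟨φ, hφ⟩ := hP
  exact ⟨∼φ, fun v => by rw [Formula.realize_not, hφ]⟩

theorem ArithDef.and {P Q : (α → ℤ) → Prop} (hP : ArithDef P) (hQ : ArithDef Q) :
    ArithDef fun v => P v ∧ Q v := by
  obtain ⟨φ, hφ⟩ := hP
  obtain ⟨ψ, hψ⟩ := hQ
  exact ⟨φ ⊓ ψ, fun v => by rw [Formula.realize_inf, hφ, hψ]⟩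

theorem ArithDef.or {P Q : (α → ℤ) → Prop} (hP : ArithDef P) (hQ : ArithDef Q) :
    ArithDef fun v => P v ∨ Q v := by
  obtain ⟨φ, hφ⟩ := hP
  obtain ⟨ψ, hψ⟩ := hQ
  exact ⟨φ ⊔ ψ, fun v => by rw [Formula.realize_sup, hφ, hψ]⟩

theorem ArithDef.imp {P Q : (α → ℤ) → Prop} (hP : ArithDef P) (hQ : ArithDef Q) :
    ArithDef fun v => P v → Q v := by
  obtain ⟨φ, hφ⟩ := hP
  obtain ⟨ψ, hψ⟩ := hQ
  exact ⟨φ.imp ψ, fun v => by rw [Formula.realize_imp, hφ, hψ]⟩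

theorem ArithDef.lt {f g : (α → ℤ) → ℤ} (hf : ArithTerm f) (hg : ArithTerm g) :
    ArithDef fun v => f v < g v := by
  simpa only [not_le] using (ArithDef.le hg hf).not

theorem ArithDef.finite_forall [Finite β] {P : β → (α → ℤ) → Prop} (hP : ∀ b, ArithDef (P b)) :
    ArithDef fun v => ∀ b, P b v := by
  choose φ hφ using hP
  exact ⟨Formula.iInf φ, fun v => by simp only [Formula.realize_iInf, hφ]⟩

/-- The bound tuple becomes the right summand of the variable type. Finiteness of `β` keeps the
block of quantifiers first-order. -/
theorem ArithDef.exists [Finite β] {P : (α → ℤ) → (β → ℤ) → Prop}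
    (hP : ArithDef fun u : α ⊕ β → ℤ => P (fun a => u (.inl a)) fun b => u (.inr b)) :
    ArithDef fun v => ∃ w, P v w := by
  obtain ⟨φ, hφ⟩ := hP
  exact ⟨φ.iExs β, fun v => by simp only [Formula.realize_iExs, hφ, Sum.elim_inl, Sum.elim_inr]⟩

theorem ArithDef.forall [Finite β] {P : (α → ℤ) → (β → ℤ) → Prop}
    (hP : ArithDef fun u : α ⊕ β → ℤ => P (fun a => u (.inl a)) fun b => u (.inr b)) :
    ArithDef fun v => ∀ w, P v w := by
  simpa only [not_exists, not_not] using (ArithDef.exists (P := fun v w => ¬ P v w) hP.not).not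

theorem ArithDef.exists_int {P : (α → ℤ) → ℤ → Prop}
    (hP : ArithDef fun u : α ⊕ Unit → ℤ => P (fun a => u (.inl a)) (u (.inr ()))) :
    ArithDef fun v => ∃ z, P v z := by
  have := ArithDef.exists (P := fun v (w : Unit → ℤ) => P v (w ())) hP
  convert! this using 2 with v
  exact ⟨fun ⟨z, h⟩ => ⟨fun _ => z, h⟩, fun ⟨w, h⟩ => ⟨w (), h⟩⟩

theorem ArithDef.forall_int {P : (α → ℤ) → ℤ → Prop}
    (hP : ArithDef fun u : α ⊕ Unit → ℤ => P (fun a => u (.inl a)) (u (.inr ()))) :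
    ArithDef fun v => ∀ z, P v z := by
  simpa only [not_exists, not_not] using
    (ArithDef.exists_int (P := fun v z => ¬ P v z) hP.not).not

theorem ArithDef.comp {P : (β → ℤ) → Prop} (hP : ArithDef P) {g : (α → ℤ) → β → ℤ}
    (hg : ∀ b, ArithTerm fun v => g v b) : ArithDef fun v => P (g v) := by
  obtain ⟨φ, hφ⟩ := hP
  choose s hs using hg
  refine ⟨BoundedFormula.subst φ s, fun v => ?_⟩
  rw [Formula.Realize, BoundedFormula.realize_subst, ← Formula.Realize, hφ]
  simp only [hs]

/-! ### Coding of finite sequences and transitive closure -/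

/-- The `i`-th value of the sequence of integers with the Gödel code `a, b, c` is `r`. -/
def Coded (a b c i r : ℤ) : Prop :=
  0 < b * (i + 1) + 1 ∧ a % (b * (i + 1) + 1) = r + c

theorem Coded.unique {a b c i r r' : ℤ} (h : Coded a b c i r) (h' : Coded a b c i r') :
    r = r' := by
  have := h.2.symm.trans h'.2
  lia

/-- Gödel's β-function codes finite lists of natural numbers. Adding a large `c` makes the values up
to `n` nonnegative, and `c` is kept as part of the code. -/
theorem exists_coded (f : ℕ → ℤ) (n : ℕ) :
    ∃ a b c : ℤ, ∀ i : ℕ, i ≤ n → Coded a b c i (f i) := by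
  obtain ⟨c, hc⟩ : ∃ c : ℤ, ∀ i ≤ n, 0 ≤ f i + c := by
    refine ⟨∑ j ∈ Finset.range (n + 1), |f j|, fun i hi => ?_⟩
    have := Finset.single_le_sum (f := fun j => |f j|) (fun j _ => abs_nonneg (f j))
      (Finset.mem_range.2 (Nat.lt_succ_of_le hi))
    have := neg_abs_le (f i)
    lia
  set l : List ℕ := List.ofFn fun i : Fin (n + 1) => (f i + c).toNat with hl
  refine ⟨(Nat.unbeta l).unpair.1, (Nat.unbeta l).unpair.2, c, fun i hi => ⟨by positivity, ?_⟩⟩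
  have h := Nat.beta_unbeta_coe l ⟨i, by simp [hl]; lia⟩
  rw [Nat.beta] at h
  have h' : l[i]'(by simp [hl]; lia) = (f i + c).toNat := by
    simp only [hl, List.getElem_ofFn]
  simp only [Fin.getElem_fin, h'] at h
  have := congrArg (Nat.cast : ℕ → ℤ) h
  rw [Int.toNat_of_nonneg (hc i hi)] at this
  rw [← this]
  push_cast
  rw [mul_comm]

theorem ArithDef.coded {a b c i r : (α → ℤ) → ℤ} (ha : ArithTerm a) (hb : ArithTerm b)
    (hc : ArithTerm c) (hi : ArithTerm i) (hr : ArithTerm r) :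
    ArithDef fun v => Coded (a v) (b v) (c v) (i v) (r v) := by
  -- The remainder is not a term of the language; it is eliminated by quantifying over the quotient
  -- `q`.
  have e : ∀ a b c i r : ℤ, Coded a b c i r ↔
      ∃ q, (0 ≤ r + c ∧ r + c < b * (i + 1) + 1) ∧ a = q * (b * (i + 1) + 1) + (r + c) := by
    intro a b c i r
    constructor
    · rintro ⟨h₀, h⟩
      refine ⟨a / (b * (i + 1) + 1), ⟨?_, ?_⟩, ?_⟩
      · rw [← h]; exact Int.emod_nonneg _ h₀.ne'
      · rw [← h]; exact Int.emod_lt_of_pos _ h₀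
      · rw [← h, mul_comm]; exact (Int.mul_ediv_add_emod _ _).symm
    · rintro ⟨q, ⟨h₀, h₁⟩, h⟩
      refine ⟨by lia, ?_⟩
      rw [h, mul_comm, Int.mul_add_emod_self_left, Int.emod_eq_of_lt h₀ h₁]
  simp only [e]
  have lift : ∀ {f : (α → ℤ) → ℤ}, ArithTerm f →
      ArithTerm fun u : α ⊕ Unit → ℤ => f fun a => u (.inl a) :=
    fun hf => hf.comp fun _ => .var _
  have hm : ArithTerm fun u : α ⊕ Unit → ℤ =>
      b (fun a => u (.inl a)) * (i (fun a => u (.inl a)) + 1) + 1 :=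
    ((lift hb).mul ((lift hi).add .one)).add .one
  have hrc := (lift hr).add (lift hc)
  exact .exists_int (((ArithDef.le .zero hrc).and (.lt hrc hm)).and
    (.eq (lift ha) (((ArithTerm.var _).mul hm).add hrc)))

theorem reflTransGen_iff_exists_seq {S : Type*} {R : S → S → Prop} {s t : S} :
    Relation.ReflTransGen R s t ↔
      ∃ (n : ℕ) (f : ℕ → S), f 0 = s ∧ f n = t ∧ ∀ i < n, R (f i) (f (i + 1)) := by
  constructor
  · intro h
    induction h with
    | refl => exact ⟨0, fun _ => s, rfl, rfl, by simp⟩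
    | @tail b c _ h ih =>
      obtain ⟨n, f, h₀, hn, hf⟩ := ih
      refine ⟨n + 1, fun i => if i ≤ n then f i else c, by simp [h₀], by simp, fun i hi => ?_⟩
      by_cases e : i + 1 ≤ n
      · simpa [e, (show i ≤ n by lia)] using hf i (by lia)
      · obtain rfl : i = n := by lia
        simpa [hn] using h
  · rintro ⟨n, f, rfl, rfl, hf⟩
    induction n with
    | zero => exact .refl
    | succ n ih => exact (ih fun i hi => hf i (by lia)).tail (hf n (by lia))

/-- A run is coded coordinatewise, with one triple of integers for each `y`. Decoding is unique, so
the end of one step is the start of the next. -/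
theorem reflTransGen_iff_coded {R : (β → ℤ) → (β → ℤ) → Prop} {s t : β → ℤ} :
    Relation.ReflTransGen R s t ↔ ∃ (a b c : β → ℤ) (n : ℤ),
      (0 ≤ n ∧ (∀ y, Coded (a y) (b y) (c y) 0 (s y)) ∧ ∀ y, Coded (a y) (b y) (c y) n (t y)) ∧
      ∀ i, 0 ≤ i ∧ i < n → ∃ s' t', ((∀ y, Coded (a y) (b y) (c y) i (s' y)) ∧
        ∀ y, Coded (a y) (b y) (c y) (i + 1) (t' y)) ∧ R s' t' := by
  rw [reflTransGen_iff_exists_seq]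
  constructor
  · rintro ⟨n, f, rfl, rfl, hf⟩
    choose a b c h using fun y => exists_coded (fun i => f i y) n
    refine ⟨a, b, c, n, ⟨by lia, fun y => by simpa using h y 0 (by lia), fun y => h y n le_rfl⟩, ?_⟩
    rintro i ⟨h₀, hi⟩
    lift i to ℕ using h₀
    exact ⟨f i, f (i + 1), ⟨fun y => h y i (by lia), fun y => by
      simpa using h y (i + 1) (by lia)⟩, hf i (by lia)⟩
  · rintro ⟨a, b, c, n, ⟨hn, hs, ht⟩, h⟩
    lift n to ℕ using hn
    -- Below `n` the step out of `i` provides the value, at `n` the final tuple does. Past `n` the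
    -- value is irrelevant, but `choose` needs a total function.
    have hex : ∀ i : ℕ, ∃ r : β → ℤ, i ≤ n → ∀ y, Coded (a y) (b y) (c y) i (r y) := by
      intro i
      rcases lt_trichotomy i n with hi | rfl | hi
      · obtain ⟨s', -, ⟨h₁, -⟩, -⟩ := h i ⟨by lia, by lia⟩
        exact ⟨s', fun _ => h₁⟩
      · exact ⟨t, fun _ => ht⟩
      · exact ⟨t, fun h => by lia⟩
    choose f hf using hex
    have huniq : ∀ i ≤ n, ∀ r : β → ℤ, (∀ y, Coded (a y) (b y) (c y) i (r y)) → f i = r :=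
      fun i hi r hr => funext fun y => (hf i hi y).unique (hr y)
    refine ⟨n, f, huniq 0 (by lia) _ (by simpa using hs), huniq n le_rfl _ ht, fun i hi => ?_⟩
    obtain ⟨s', t', ⟨h₁, h₂⟩, hR⟩ := h i ⟨by lia, by lia⟩
    rwa [huniq i (by lia) _ h₁, huniq (i + 1) (by lia) _ (by simpa using h₂)]

/-- The reflexive transitive closure of a definable relation is definable. -/
theorem ArithDef.reflTransGen [Finite β] {R : (α → ℤ) → (β → ℤ) → (β → ℤ) → Prop}
    (hR : ArithDef fun u : α ⊕ (β ⊕ β) → ℤ =>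
      R (fun a => u (.inl a)) (fun b => u (.inr (.inl b))) fun b => u (.inr (.inr b)))
    {g : (γ → ℤ) → α → ℤ} {s t : (γ → ℤ) → β → ℤ} (hg : ∀ a, ArithTerm fun v => g v a)
    (hs : ∀ b, ArithTerm fun v => s v b) (ht : ∀ b, ArithTerm fun v => t v b) :
    ArithDef fun v => Relation.ReflTransGen (R (g v)) (s v) (t v) := by
  simp only [reflTransGen_iff_coded]
  refine .exists (.exists (.exists (.exists_int (.and (.and ?_ (.and ?_ ?_))
    (.forall_int (.imp ?_ (.exists (.exists (.and (.and ?_ ?_) ?_)))))))))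
  · exact .le .zero (.var _)
  · exact .finite_forall fun y => .coded (.var _) (.var _) (.var _) .zero
      ((hs y).comp fun _ => .var _)
  · exact .finite_forall fun y => .coded (.var _) (.var _) (.var _) (.var _)
      ((ht y).comp fun _ => .var _)
  · exact .and (.le .zero (.var _)) (.lt (.var _) (.var _))
  · exact .finite_forall fun y => .coded (.var _) (.var _) (.var _) (.var _) (.var _)
  · exact .finite_forall fun y => .coded (.var _) (.var _) (.var _) ((ArithTerm.var _).add .one)
      (.var _)
  · refine hR.comp (g := fun u => Sum.elim (g fun a => u (Sum.inl (Sum.inl (Sum.inl (Sum.inl (Sum.inl (Sum.inl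
      (Sum.inl a)))))))) (Sum.elim (fun b => u (Sum.inl (Sum.inr b))) fun b => u (Sum.inr b))) ?_
    rintro (a | b | b)
    · exact (hg a).comp fun _ => .var _
    · exact .var _
    · exact .var _

end Definability

/-! ### Expressiveness -/

section Expressiveness

variable {V : Type u} [DecidableEq V] {X : Finset V}

/-- The state that is given by `w` on the variables in `X`, and by `σ` elsewhere. -/
def override (σ : State V) (w : X → ℤ) : State V :=
  fun y => if h : y ∈ X then w ⟨y, h⟩ else σ y

theorem override_self (σ : State V) : override σ (fun y : X => σ y) = σ := by
  funext y
  by_cases h : y ∈ X <;> simp [override, h]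

theorem override_override (σ : State V) (w w' : X → ℤ) :
    override (override σ w) w' = override σ w' := by
  funext y
  by_cases h : y ∈ X <;> simp [override, h]

theorem override_injective (σ : State V) :
    Function.Injective (override σ : (X → ℤ) → State V) := by
  intro w w' h
  funext y
  simpa [override] using congrFun h y

/-- Although `V` may be infinite, quantifying over final states thus reduces to quantifying over
finitely many integers. -/
theorem exists_eq_override {p : Prog V} (hp : p.vars ⊆ X) {σ τ : State V} (h : τ ∈ den p σ) :
    ∃ w : X → ℤ, τ = override σ w := by
  refine ⟨fun y => τ y, funext fun y => ?_⟩
  by_cases hy : y ∈ X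
  · simp [override, hy]
  · simp [override, hy, den_eq_of_notMem h fun h => hy (hp h)]

theorem ArithTerm.override {α : Type v} {s : (α → ℤ) → State V} {w : (α → ℤ) → X → ℤ}
    (hs : ∀ y, ArithTerm fun v => s v y) (hw : ∀ y, ArithTerm fun v => w v y) (y : V) :
    ArithTerm fun v => override (s v) (w v) y := by
  by_cases h : y ∈ X
  · simpa only [HoareVC.override, h, dif_pos] using hw ⟨y, h⟩
  · simpa only [HoareVC.override, h, dif_neg, not_false_iff] using hs y

/-- The graph of a program, as a relation between a state and values of the variables in `X`. -/
def Graph (X : Finset V) (p : Prog V) (σ : State V) (w : X → ℤ) : Prop :=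
  override σ w ∈ den p σ

theorem graph_seq {p₀ p₁ : Prog V} (hp : p₀.vars ⊆ X) {σ : State V} {w : X → ℤ} :
    Graph X (.seq p₀ p₁) σ w ↔ ∃ w', Graph X p₀ σ w' ∧ Graph X p₁ (override σ w') w := by
  simp only [Graph, mem_den_seq, override_override]
  constructor
  · rintro ⟨ρ, h₀, h₁⟩
    obtain ⟨w', rfl⟩ := exists_eq_override hp h₀
    exact ⟨w', h₀, h₁⟩
  · rintro ⟨w', h₀, h₁⟩
    exact ⟨_, h₀, h₁⟩

/-- The initial state stays fixed as a parameter and only the finite tuple on `X` evolves, which is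
the form that `ArithDef.reflTransGen` needs. -/
theorem graph_while {B : arith.Formula V} {hB : B.IsQF} {p : Prog V} (hp : p.vars ⊆ X)
    {σ : State V} {w : X → ℤ} :
    Graph X (.while B hB p) σ w ↔
      Relation.ReflTransGen
        (fun w' w'' => B.Realize (override σ w') ∧ Graph X p (override σ w') w'')
        (fun y => σ y) w ∧ ¬ B.Realize (override σ w) := by
  simp only [Graph, mem_den_while, override_override]
  refine and_congr_left fun _ => ⟨fun h => ?_, fun h => ?_⟩
  · suffices H : ∀ τ, Relation.ReflTransGen (LoopStep B p) σ τ → ∃ w' : X → ℤ, τ = override σ w' ∧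
        Relation.ReflTransGen (fun w' w'' => B.Realize (override σ w') ∧
          override σ w'' ∈ den p (override σ w')) (fun y => σ y) w' by
      obtain ⟨w', e, h'⟩ := H _ h
      rwa [override_injective σ e]
    intro τ h
    induction h with
    | refl => exact ⟨_, (override_self σ).symm, .refl⟩
    | tail _ h ih =>
      obtain ⟨w', rfl, h'⟩ := ih
      obtain ⟨w'', rfl⟩ := exists_eq_override hp h.2
      rw [override_override] at h
      exact ⟨w'', override_override .., h'.tail h⟩
  · have : Relation.ReflTransGen (LoopStep B p) (override σ fun y : X => σ y) (override σ w) :=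
      h.lift (override σ) fun _ _ h => h
    rwa [override_self] at this

/-- The graph of a program is arithmetically definable. -/
theorem arithDef_graph {p : Prog V} (hp : p.vars ⊆ X) :
    ArithDef fun u : V ⊕ X → ℤ => Graph X p (fun y => u (.inl y)) fun y => u (.inr y) := by
  have hform : ∀ φ : arith.Formula V, ArithDef φ.Realize := fun φ => ⟨φ, fun _ => Iff.rfl⟩
  have hupd : ∀ (x : V) (t : arith.Term V) (y : V),
      ArithTerm fun σ : State V => Function.update σ x (t.realize σ) y := by
    intro x t y
    by_cases h : y = x
    · subst h
      exact ⟨t, by simp⟩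
    · exact ⟨Term.var y, by simp [h]⟩
  -- Treats `skip` and assignment together: equality of states is a finite conjunction once `f`
  -- changes nothing outside `X`.
  have heq : ∀ f : State V → State V, (∀ y, ArithTerm fun σ => f σ y) →
      (∀ σ, ∀ y ∉ X, f σ y = σ y) →
      ArithDef fun u : V ⊕ X → ℤ =>
        override (fun y => u (.inl y)) (fun y : X => u (.inr y)) = f fun y => u (.inl y) := by
    intro f hf hX
    have : ∀ σ (w : X → ℤ), override σ w = f σ ↔ ∀ y : X, w y = f σ y := by
      intro σ w
      rw [funext_iff]
      constructor
      · intro h y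
        simpa [override] using h y
      · intro h y
        by_cases hy : y ∈ X
        · simpa [override, hy] using h ⟨y, hy⟩
        · simp [override, hy, hX σ y hy]
    simp only [this]
    exact .finite_forall fun y => .eq (.var _) ((hf y).comp fun _ => .var _)
  induction p with
  | skip =>
    simp only [Graph, den, Part.mem_some_iff]
    exact heq (fun σ => σ) (fun y => .var y) fun _ _ _ => rfl
  | assign x t =>
    simp only [Graph, den, Part.mem_some_iff]
    refine heq _ (hupd x t) fun σ y hy => Function.update_of_ne ?_ _ _
    rintro rfl
    exact hy (hp (by simp [Prog.vars]))
  | seq p₀ p₁ ih₀ ih₁ =>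
    simp only [Prog.vars, Finset.union_subset_iff] at hp
    simp only [graph_seq hp.1]
    refine .exists (.and ?_ ?_)
    · refine (ih₀ hp.1).comp (g := fun u => Sum.elim (fun y => u (Sum.inl (Sum.inl y)))
        fun y => u (Sum.inr y)) ?_
      rintro (y | y) <;> exact .var _
    · refine (ih₁ hp.2).comp (g := fun u => Sum.elim (override (fun y => u (Sum.inl (Sum.inl y)))
        fun y : X => u (Sum.inr y)) fun y => u (Sum.inl (Sum.inr y))) ?_
      rintro (y | y)
      · exact .override (fun _ => .var _) (fun _ => .var _) y
      · exact .var _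
  | ite B hB p₀ p₁ ih₀ ih₁ =>
    simp only [Prog.vars, Finset.union_subset_iff] at hp
    simp only [Graph, mem_den_ite]
    have := (hform B).comp (g := fun (u : V ⊕ X → ℤ) y => u (.inl y)) fun _ => .var _
    exact .or (.and this (ih₀ hp.1.2)) (.and this.not (ih₁ hp.2))
  | _ B hB p ih =>
    simp only [Prog.vars, Finset.union_subset_iff] at hp
    simp only [graph_while hp.2]
    refine .and (.reflTransGen (R := fun σ w' w'' => B.Realize (override σ w') ∧
      Graph X p (override σ w') w'') (.and ?_ ?_) (fun _ => .var _) (fun _ => .var _)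
      fun _ => .var _) (.not ?_)
    · exact (hform B).comp (.override (fun _ => .var _) fun _ => .var _)
    · refine (ih hp.2).comp (g := fun u => Sum.elim (override (fun y => u (Sum.inl y))
        fun y : X => u (Sum.inr (Sum.inl y))) fun y => u (Sum.inr (Sum.inr y))) ?_
      rintro (y | y)
      · exact .override (s := fun u y => u (Sum.inl y)) (w := fun u y => u (Sum.inr (Sum.inl y)))
          (fun _ => .var _) (fun _ => .var _) y
      · exact .var _
    · exact (hform B).comp (.override (fun _ => .var _) fun _ => .var _)

/-- Arithmetic is expressive: weakest liberal preconditions are definable. -/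
theorem exists_formula_wlp (p : Prog V) (ψ : arith.Formula V) :
    ∃ χ : arith.Formula V, ∀ σ : State V, χ.Realize σ ↔ wlp p ψ.Realize σ := by
  have e : ∀ σ, wlp p ψ.Realize σ ↔
      ∀ w : p.vars → ℤ, Graph p.vars p σ w → ψ.Realize (override σ w) := by
    refine fun σ => ⟨fun h w hw => h _ hw, fun h τ hτ => ?_⟩
    obtain ⟨w, rfl⟩ := exists_eq_override subset_rfl hτ
    exact h w hτ
  have : ArithDef fun σ : State V => wlp p ψ.Realize σ := by
    simp only [e]
    exact .forall (.imp (arithDef_graph subset_rfl) (ArithDef.comp (P := ψ.Realize)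
      ⟨ψ, fun _ => Iff.rfl⟩ (.override (fun _ => .var _) fun _ => .var _)))
  exact this

/-- Relative completeness of the Hoare calculus. -/
theorem provable_of_forall_wlp {p : Prog V} {φ ψ : arith.Formula V}
    (h : ∀ σ : State V, φ.Realize σ → wlp p ψ.Realize σ) : Provable φ p ψ := by
  induction p generalizing φ ψ with
  | skip =>
    exact .consequence (fun σ hσ => h σ hσ σ (by simp [den])) (.skip ψ) fun _ => id
  | assign x t =>
    refine .consequence (fun σ hσ => ?_) (.assign ψ x t) fun _ => id
    exact realize_substVar.2 (h σ hσ _ (by simp [den]))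
  | seq p₀ p₁ ih₀ ih₁ =>
    -- Here expressiveness enters: the intermediate assertion must be a formula.
    obtain ⟨χ, hχ⟩ := exists_formula_wlp p₁ ψ
    exact .seq (ih₀ fun σ hσ ρ hρ => (hχ ρ).2 fun τ hτ => h σ hσ τ (mem_den_seq.2 ⟨ρ, hρ, hτ⟩))
      (ih₁ fun σ => (hχ σ).1)
  | ite B hB p₀ p₁ ih₀ ih₁ =>
    refine .ite (ih₀ fun σ hσ τ hτ => ?_) (ih₁ fun σ hσ τ hτ => ?_)
    · rw [Formula.realize_inf] at hσ
      exact h σ hσ.1 τ (mem_den_ite.2 (.inl ⟨hσ.2, hτ⟩))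
    · rw [Formula.realize_inf, Formula.realize_not] at hσ
      exact h σ hσ.1 τ (mem_den_ite.2 (.inr ⟨hσ.2, hτ⟩))
  | _ B hB p ih =>
    -- The formula for the `wlp` of the loop serves as invariant; the rule of consequence connects
    -- it with `φ` and `ψ`.
    obtain ⟨χ, hχ⟩ := exists_formula_wlp (.while B hB p) ψ
    refine .consequence (fun σ hσ => (hχ σ).2 (h σ hσ)) (.while (ih fun σ hσ ρ hρ => ?_))
      fun σ hσ => ?_
    · rw [Formula.realize_inf, hχ] at hσ
      exact (hχ ρ).2 (wlp_while_step hσ.1 hσ.2 ρ hρ)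
    · rw [Formula.realize_inf, Formula.realize_not, hχ] at hσ
      exact wlp_while_exit hσ.1 hσ.2

end Expressiveness

end HoareVC

theorem mainTheorem6 {V : Type*} [DecidableEq V]
    (φ : HoareVC.arith.Formula V) (p : HoareVC.Prog V) (ψ : HoareVC.arith.Formula V) :
    (HoareVC.Provable φ p ψ ↔ HoareVC.Valid φ p ψ) ∧
      (HoareVC.Valid φ p ψ ↔ (HoareVC.vc φ p ψ).TrueInZ) :=
  ⟨⟨HoareVC.Provable.valid, HoareVC.provable_of_forall_wlp⟩,
    HoareVC.valid_iff_trueInZ_vc φ p ψ⟩
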